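/- **Definitions.** For integers $d\ge 0$, $\boldsymbol s=(s_1,\dots,s_d)\in\mathbb C^d$ and $w\in\mathbb C\setminus(-\infty,-1]$, define inductively $\Psi^0(\varnothing;w)=1$ and, for $d\ge 1$, $$\Psi^d(s_1,\dots,s_d;w)=\sum_{j=1}^\infty\left\{\frac{\Psi^{d-1}(s_2,\dots,s_d;j-1)}{j^{s_1}}-\frac{\Psi^{d-1}(s_2,\dots,s_d;w+j-1)}{(w+j)^{s_1}}\right\},$$ where powers are taken with the principal branch of the logarithm. For $\boldsymbol q=(q_1,\dots,q_d)\in(\mathbb C^\times)^d$ such that $-\pi<\arg q_i+\cdots+\arg q_j<\pi$ for all $1\le i\le j\le d$ (in particular for $\boldsymbol q\in(0,\infty)^d$) and $w\in\mathbb C$, define inductively $G^0(\varnothing;w)=1$, $G^1(q;w)=\frac{1-q^w}{1-q}$ if $q\ne 1$ and $G^1(1;w)=w$, and, for $d\ge 2$, $$G^d(\boldsymbol q;w)=\begin{cases}\dfrac{1}{1-q_d}\left\{G^{d-1}(q_1,\dots,q_{d-1};w)-G^{d-1}(q_1,\dots,q_{d-2},q_{d-1}q_d;w)\right\}&(q_d\ne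 1),\\[2mm] q_{d-1}\dfrac{\partial}{\partial q_{d-1}}G^{d-1}(q_1,\dots,q_{d-1};w)&(q_d=1).\end{cases}$$ Write $\Psi=\Psi^d$ and $G=G^d$. **Theorem.** Let $d\ge 0$. 1. If $\operatorname{Re}(s_1),\dots,\operatorname{Re}(s_d)>1$ and $\operatorname{Re}(w)>-1$, then all the series in the recursive definition of $\Psi(\boldsymbol s;w)$ converge absolutely, and $$\Psi(\boldsymbol s;w)=\frac{1}{\prod_{m=1}^d\Gamma(s_m)}\int_0^1\!\cdots\!\int_0^1 G(\boldsymbol q;w)\prod_{m=1}^d(-\log q_m)^{s_m-1}\,dq_1\cdots dq_d$$ $$=\frac{1}{\prod_{m=1}^d\Gamma(s_m)}\int_0^\infty\!\cdots\!\int_0^\infty G(e^{-x_1},\dots,e^{-x_d};w)\prod_{m=1}^d\left(x_m^{s_m-1}e^{-x_m}\right)dx_1\cdots dx_d.$$ 2. Both integrals converge absolutely for $\operatorname{Re}(s_1),\dots,\operatorname{Re}(s_d)>0$ and $\operatorname{Re}(w)>-1$, uniformly for $(\boldsymbol s,w)$ in any compact subset $K$ of that region; that is, for every $\varepsilon>0$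 there is a compact subset $C$ of the open domain of integration ($(0,1)^d$, respectively $(0,\infty)^d$) such that for all $(\boldsymbol s,w)\in K$ the integral of the absolute value of the integrand over the complement of $C$ is less than $\varepsilon$. 3. Consequently each of the two right-hand sides in part 1 is a holomorphic function of $(\boldsymbol s,w)$ on the region $\operatorname{Re}(s_1),\dots,\operatorname{Re}(s_d)>0$, $\operatorname{Re}(w)>-1$, and it gives an analytic continuation to that region of the function $\Psi(\boldsymbol s;w)$, originally given for $\operatorname{Re}(s_1),\dots,\operatorname{Re}(s_d)>1$. -/

import Mathlib

noncomputable section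

namespace MultipleHarmonic

/-- The `j`-th term (`j ≥ 0`, standing for the summation index `j + 1 ≥ 1`) of the series that
defines `Ψ^d` from `f = Ψ^{d-1}(s_2, …, s_d; ·)`, with `s₁` the first exponent. -/
def psiTerm (f : ℂ → ℂ) (s₁ w : ℂ) (j : ℕ) : ℂ :=
  f (j : ℂ) / ((j : ℂ) + 1) ^ s₁ - f (w + (j : ℂ)) / (w + ((j : ℂ) + 1)) ^ s₁

/-- The interpolant `Ψ^d(s; w)` of the multiple harmonic sums. -/
def Psi : (d : ℕ) → (Fin d → ℂ) → ℂ → ℂ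
  | 0, _, _ => 1
  | d + 1, s, w => ∑' j : ℕ, psiTerm (Psi d (Fin.tail s)) (s 0) w j

/-- Every series that occurs in the recursive definition of `Ψ^d(s; w)` converges absolutely
(for complex series, `Summable` is absolute convergence). -/
def PsiConverges : (d : ℕ) → (Fin d → ℂ) → ℂ → Prop
  | 0, _, _ => True
  | d + 1, s, w =>
      Summable (psiTerm (Psi d (Fin.tail s)) (s 0) w) ∧
        ∀ j : ℕ, PsiConverges d (Fin.tail s) (j : ℂ) ∧ PsiConverges d (Fin.tail s) (w + (j : ℂ))

open Classical in
/-- The function `G^d(q; w)`. It is only meant for `q` in the domain of those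
`(q_1, …, q_d) ∈ (ℂ ∖ {0})^d` for which all sums `arg q_i + ⋯ + arg q_j` lie in `(-π, π)`, which
contains `(0, ∞)^d`. For `d ≥ 2`, `Fin.init q` is `(q_1, …, q_{d-1})`, and updating its last entry
to `z` gives `(q_1, …, q_{d-2}, z)`. -/
def G : (d : ℕ) → (Fin d → ℂ) → ℂ → ℂ
  | 0, _, _ => 1
  | 1, q, w => if q 0 = 1 then w else (1 - (q 0) ^ w) / (1 - q 0)
  | d + 2, q, w =>
      if q (Fin.last (d + 1)) = 1 then
        Fin.init q (Fin.last d) *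
          deriv (fun z : ℂ => G (d + 1) (Function.update (Fin.init q) (Fin.last d) z) w)
            (Fin.init q (Fin.last d))
      else
        (1 / (1 - q (Fin.last (d + 1)))) *
          (G (d + 1) (Fin.init q) w -
            G (d + 1) (Function.update (Fin.init q) (Fin.last d)
              (Fin.init q (Fin.last d) * q (Fin.last (d + 1)))) w)

/-- The integrand `G(q; w) ∏ (-log q_m)^{s_m - 1}` at `p = (s, w)`, for `q ∈ (0, 1)^d`. -/
def unitIntegrand (d : ℕ) (p : (Fin d → ℂ) × ℂ) (q : Fin d → ℝ) : ℂ :=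
  G d (fun m => (q m : ℂ)) p.2 * ∏ m, ((-Real.log (q m) : ℝ) : ℂ) ^ (p.1 m - 1)

/-- The integrand `G(e^{-x_1}, …, e^{-x_d}; w) ∏ x_m^{s_m - 1} e^{-x_m}` at `p = (s, w)`,
for `x ∈ (0, ∞)^d`. -/
def mellinIntegrand (d : ℕ) (p : (Fin d → ℂ) × ℂ) (x : Fin d → ℝ) : ℂ :=
  G d (fun m => Complex.exp (-(x m : ℂ))) p.2 *
    ∏ m, ((x m : ℂ) ^ (p.1 m - 1) * Complex.exp (-(x m : ℂ)))

/-- The open cube `(0, 1)^d`. -/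
def openCube (d : ℕ) : Set (Fin d → ℝ) := Set.pi Set.univ fun _ => Set.Ioo 0 1

/-- The open orthant `(0, ∞)^d`. -/
def openOrthant (d : ℕ) : Set (Fin d → ℝ) := Set.pi Set.univ fun _ => Set.Ioi 0

/-- `(1 / ∏ Γ(s_m)) ∫_{(0,1)^d} G(q; w) ∏ (-log q_m)^{s_m - 1} dq` as a function of `(s, w)`. -/
def unitIntegral (d : ℕ) (p : (Fin d → ℂ) × ℂ) : ℂ :=
  (1 / ∏ m, Complex.Gamma (p.1 m)) * ∫ q in openCube d, unitIntegrand d p q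

/-- `(1 / ∏ Γ(s_m)) ∫_{(0,∞)^d} G(e^{-x}; w) ∏ x_m^{s_m - 1} e^{-x_m} dx` as a function of
`(s, w)`. -/
def mellinIntegral (d : ℕ) (p : (Fin d → ℂ) × ℂ) : ℂ :=
  (1 / ∏ m, Complex.Gamma (p.1 m)) * ∫ x in openOrthant d, mellinIntegrand d p x

/-- The region `Re s_1, …, Re s_d > c`, `Re w > -1` in `ℂ^d × ℂ`. -/
def region (d : ℕ) (c : ℝ) : Set ((Fin d → ℂ) × ℂ) :=
  {p | (∀ m, c < (p.1 m).re) ∧ -1 < p.2.re}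

/-- The improper integral of `F p` over the open set `D` converges absolutely for all `p ∈ K`,
and it does so uniformly on `K`: outside a suitable compact subset of `D`, which does not depend
on `p ∈ K`, the integral of the absolute value is arbitrarily small. -/
def ConvergesAbsUniformlyOn {d : ℕ} {P : Type*} (F : P → (Fin d → ℝ) → ℂ)
    (D : Set (Fin d → ℝ)) (K : Set P) : Prop :=
  (∀ p ∈ K, MeasureTheory.IntegrableOn (F p) D) ∧
    ∀ ε : ℝ, 0 < ε → ∃ C : Set (Fin d → ℝ), IsCompact C ∧ C ⊆ D ∧
      ∀ p ∈ K, ∫ x in D \ C, ‖F p x‖ < ε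

end MultipleHarmonic

end

/-! In the coordinates `q = e^{-x}` the recursion for `G` is a divided difference in the last
variable, with `1 - e^{-z}` as denominator. It commutes with operations on the first variable, so
the geometric series for `d = 1` propagates to (`hasSum_G`) `G(e^{-x}; w) = ∑_j (e^{-j x_1}
G(e^{-x'}; j) - e^{-(w+j) x_1} G(e^{-x'}; w+j))`, where `x' = (x_2, …, x_d)`. By Euler's integral `∫
t^{s-1} e^{-(u+1)t} dt = Γ(s) / (u+1)^s`, integrating this termwise against the Mellin kernel
reproduces the series defining `Ψ`, and induction on `d` gives the integral formula.

Two bounds on `G` carry the analysis. The triangle inequality gives a product of factors with simple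
poles at `x_m = 0` (`norm_G_le_prod_poleFactor`). It is integrable only for `Re s_m > 1`, but it is
uniform in all `u` with `Re u ≥ -a`, as the sum over `j` requires. For `Re s_m > 0` the poles must
cancel: each numerator vanishes at `z = 0`, so the quotient extends holomorphically to a half-strip
around `[0, ∞)`, and the Schwarz lemma bounds it there. This yields `|G| ≤ C e^{a ∑ x_m}` for
bounded `w` (`exists_norm_G_le`). With `a < 1` the kernel absorbs the exponential, which gives a
dominating function locally uniform in `(s, w)`, hence uniform convergence and holomorphy. -/

open MeasureTheory Filter Topology

/-! ### Holomorphic parametric integrals and Euler's integral. -/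

/-- An integral depending holomorphically on a parameter in a finite-dimensional space, with an
integrable bound that does not depend on the parameter, is holomorphic. -/
theorem differentiableOn_integral_of_dominated {E α : Type*} [NormedAddCommGroup E]
    [NormedSpace ℂ E] [FiniteDimensional ℂ E] [MeasurableSpace α] {μ : Measure α}
    {F : E → α → ℂ} {U : Set E} (hU : IsOpen U)
    (hmeas : ∀ p ∈ U, AEStronglyMeasurable (F p) μ)
    (hdiff : ∀ᵐ x ∂μ, DifferentiableOn ℂ (fun p => F p x) U)
    {B : α → ℝ} (hB : Integrable B μ) (hle : ∀ᵐ x ∂μ, ∀ p ∈ U, ‖F p x‖ ≤ B x) :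
    DifferentiableOn ℂ (fun p => ∫ x, F p x ∂μ) U := by
  intro p hp
  obtain ⟨r, hr, hrU⟩ := Metric.isOpen_iff.1 hU p hp
  have hfd : AEStronglyMeasurable (fun x => fderiv ℂ (fun p => F p x) p) μ := by
    -- Directional derivatives are limits of the measurable difference quotients at `p + v / n`;
    -- starting from `n = N` keeps these points in `U`.
    have happ : ∀ v : E, AEStronglyMeasurable (fun x => fderiv ℂ (fun p => F p x) p v) μ := by
      intro v
      have hlim : Tendsto (fun n : ℕ => p + ((n : ℂ))⁻¹ • v) atTop (𝓝 p) := by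
        have h1 : Tendsto (fun n : ℕ => ((n : ℂ))⁻¹) atTop (𝓝 0) :=
          tendsto_inv_atTop_nhds_zero_nat
        simpa using (h1.smul_const v).const_add p
      obtain ⟨N, hN⟩ := (hlim.eventually (hU.mem_nhds hp)).exists_forall_of_atTop
      have hN' : Tendsto (fun n : ℕ => n + N) atTop atTop := tendsto_add_atTop_nat N
      refine aestronglyMeasurable_of_tendsto_ae atTop
        (f := fun n x => ((n + N : ℕ) : ℂ) •
          (F (p + (((n + N : ℕ) : ℂ))⁻¹ • v) x - F p x)) (fun n => ?_) ?_
      · exact ((hmeas _ (hN _ (Nat.le_add_left _ _))).sub (hmeas _ hp)).const_smul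
          (((n + N : ℕ) : ℂ))
      · filter_upwards [hdiff] with x hx
        have hd : HasFDerivAt (fun p => F p x) (fderiv ℂ (fun p => F p x) p) p :=
          (hx.differentiableAt (hU.mem_nhds hp)).hasFDerivAt
        have := hd.lim v (l := atTop) (c := fun n : ℕ => (n : ℂ))
          (by simpa using tendsto_natCast_atTop_atTop)
        exact this.comp hN'
    let b := Module.finBasis ℂ E
    have hsum : (fun x => fderiv ℂ (fun p => F p x) p) = fun x =>
        ∑ i, (fderiv ℂ (fun p => F p x) p (b i)) • (LinearMap.toContinuousLinearMap (b.coord i)) := by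
      funext x
      ext v
      conv_lhs => rw [← b.sum_repr v, map_sum]
      simp [-Module.Basis.sum_repr, mul_comm]
    rw [hsum]
    exact Finset.aestronglyMeasurable_fun_sum _ fun i _ => (happ (b i)).smul_const _
  -- Cauchy's estimate replaces a hypothesis on the derivative: around any `q` within `r / 2` of
  -- `p`, the ball of radius `r / 2` lies in `U`, and there `F` differs from its value at `q` by at
  -- most `2 * B x`.
  refine (hasFDerivAt_integral_of_dominated_of_fderiv_le (𝕜 := ℂ)
    (F' := fun q x => fderiv ℂ (fun p => F p x) q) (bound := fun x => 2 * B x / (r / 2))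
    (Metric.ball_mem_nhds p (half_pos hr)) ?_ ?_ hfd ?_ ?_ ?_).differentiableAt.differentiableWithinAt
  · filter_upwards [hU.mem_nhds hp] with q hq using hmeas q hq
  · exact hB.mono' (hmeas p hp) (hle.mono fun x hx => hx p hp)
  · filter_upwards [hdiff, hle] with x hd hx q hq
    have hsub : Metric.ball q (r / 2) ⊆ U := by
      refine Set.Subset.trans (Metric.ball_subset_ball' ?_) hrU
      have := Metric.mem_ball.1 hq
      linarith
    refine Complex.norm_fderiv_le_div_of_mapsTo_ball (hd.mono hsub) (fun z hz => ?_) (half_pos hr)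
    rw [Metric.mem_closedBall, dist_eq_norm]
    have h1 := hx z (hsub hz)
    have h2 := hx q (hsub (Metric.mem_ball_self (half_pos hr)))
    have := norm_sub_le (F z x) (F q x)
    linarith
  · exact (hB.const_mul 2).div_const _
  · filter_upwards [hdiff] with x hd q hq
    have hq' : q ∈ U := hrU (Metric.ball_subset_ball (by linarith) hq)
    exact (hd.differentiableAt (hU.mem_nhds hq')).hasFDerivAt

theorem norm_ofReal_cpow_mul_exp {a r : ℂ} {t : ℝ} (ht : 0 < t) :
    ‖(t : ℂ) ^ (a - 1) * Complex.exp (-(r * t))‖ = t ^ (a.re - 1) * Real.exp (-(r.re * t)) := by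
  rw [norm_mul, Complex.norm_cpow_eq_rpow_re_of_pos ht, Complex.norm_exp]
  simp

theorem integrableOn_rpow_mul_exp_neg_mul {a r : ℝ} (ha : 0 < a) (hr : 0 < r) :
    IntegrableOn (fun t : ℝ => t ^ (a - 1) * Real.exp (-(r * t))) (Set.Ioi 0) := by
  have := integrableOn_rpow_mul_exp_neg_mul_rpow (p := 1) (s := a - 1) (b := r) (by linarith)
    one_pos hr
  simpa using this

theorem aestronglyMeasurable_cpow_mul_exp (a r : ℂ) (s : Set ℝ) :
    AEStronglyMeasurable (fun t : ℝ => (t : ℂ) ^ (a - 1) * Complex.exp (-(r * t)))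
      (volume.restrict s) := by
  refine Measurable.aestronglyMeasurable ?_
  fun_prop

theorem integrableOn_cpow_mul_exp_neg_mul {a r : ℂ} (ha : 0 < a.re) (hr : 0 < r.re) :
    IntegrableOn (fun t : ℝ => (t : ℂ) ^ (a - 1) * Complex.exp (-(r * t))) (Set.Ioi 0) := by
  refine (integrableOn_rpow_mul_exp_neg_mul ha hr).mono' (aestronglyMeasurable_cpow_mul_exp _ _ _) ?_
  filter_upwards [ae_restrict_mem measurableSet_Ioi] with t ht
  exact (norm_ofReal_cpow_mul_exp ht).le

/-- Euler's integral for `Γ(a) / r ^ a` with complex `r`. -/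
theorem integral_cpow_mul_exp_neg_mul_of_re_pos {a r : ℂ} (ha : 0 < a.re) (hr : 0 < r.re) :
    ∫ t : ℝ in Set.Ioi 0, (t : ℂ) ^ (a - 1) * Complex.exp (-(r * t)) =
      Complex.Gamma a / r ^ a := by
  have hopen : IsOpen {r : ℂ | 0 < r.re} := isOpen_lt continuous_const Complex.continuous_re
  have hL : DifferentiableOn ℂ
      (fun r : ℂ => ∫ t : ℝ in Set.Ioi 0, (t : ℂ) ^ (a - 1) * Complex.exp (-(r * t)))
      {r : ℂ | 0 < r.re} := by
    intro r hr
    have hr' : 0 < r.re := hr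
    -- No single integrable bound serves the whole half-plane, so holomorphy is checked on `Re z >
    -- Re r / 2`.
    have hopen' : IsOpen {z : ℂ | r.re / 2 < z.re} :=
      isOpen_lt continuous_const Complex.continuous_re
    refine ((differentiableOn_integral_of_dominated hopen'
      (B := fun t : ℝ => t ^ (a.re - 1) * Real.exp (-(r.re / 2 * t)))
      (fun p _ => aestronglyMeasurable_cpow_mul_exp _ _ _) ?_
      (integrableOn_rpow_mul_exp_neg_mul ha (half_pos hr)) ?_).differentiableAt
      (hopen'.mem_nhds ?_)).differentiableWithinAt
    · exact Eventually.of_forall fun t => by fun_prop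
    · filter_upwards [ae_restrict_mem measurableSet_Ioi] with t ht p hp
      rw [norm_ofReal_cpow_mul_exp ht]
      have h0 : (0:ℝ) < t := ht
      have : r.re / 2 < p.re := hp
      gcongr
    · simpa using hr'
  have hR : DifferentiableOn ℂ (fun r : ℂ => Complex.Gamma a / r ^ a) {r : ℂ | 0 < r.re} := by
    intro r hr
    have hs : r ∈ Complex.slitPlane := Or.inl hr
    have hne : r ^ a ≠ 0 := by
      rw [Complex.cpow_ne_zero_iff]; exact Or.inl (Complex.slitPlane_ne_zero hs)
    exact ((differentiableAt_const _).div
      (differentiableAt_id.cpow (differentiableAt_const a) hs) hne).differentiableWithinAt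
  have hconv : IsPreconnected {r : ℂ | 0 < r.re} :=
    (convex_halfSpace_re_gt 0).isPreconnected
  refine (hL.analyticOnNhd hopen).eqOn_of_preconnected_of_frequently_eq
    (hR.analyticOnNhd hopen) hconv (z₀ := 1) (by simp) ?_ hr
  -- Identity theorem: both sides agree at positive reals, and the points `1 + 1/(n+1)` accumulate
  -- at `1`.
  have htend : Tendsto (fun n : ℕ => ((1 + 1 / ((n : ℝ) + 1) : ℝ) : ℂ)) atTop (𝓝[≠] 1) := by
    refine tendsto_nhdsWithin_iff.2 ⟨?_, ?_⟩
    · have : Tendsto (fun n : ℕ => (1 + 1 / ((n : ℝ) + 1) : ℝ)) atTop (𝓝 (1 + 0)) :=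
        tendsto_one_div_add_atTop_nhds_zero_nat.const_add 1
      rw [add_zero] at this
      exact (Complex.continuous_ofReal.tendsto 1).comp this
    · refine Eventually.of_forall fun n => ?_
      have : (0:ℝ) < 1 / ((n : ℝ) + 1) := by positivity
      simp only [Set.mem_compl_iff, Set.mem_singleton_iff]
      intro h
      have := congrArg Complex.re h
      simp only [Complex.ofReal_re, Complex.one_re] at this
      linarith
  refine htend.frequently (Eventually.frequently (Eventually.of_forall fun n => ?_))
  have hpos : (0:ℝ) < 1 + 1 / ((n : ℝ) + 1) := by positivity
  generalize (1 + 1 / ((n : ℝ) + 1) : ℝ) = y at hpos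
  rw [Complex.integral_cpow_mul_exp_neg_mul_Ioi ha hpos, one_div, Complex.inv_cpow, div_eq_mul_inv,
    mul_comm]
  rw [Complex.arg_ofReal_of_nonneg hpos.le]
  exact Real.pi_pos.ne

namespace MultipleHarmonic

/-! ### `G` in exponential coordinates. -/

/-- The function `G^{d+1}(e^{-x_1}, …, e^{-x_d}, e^{-z}; w)`. -/
noncomputable def expG : (d : ℕ) → (Fin d → ℝ) → ℂ → ℂ → ℂ
  | 0, _, z, w => (1 - Complex.exp (-(w * z))) / (1 - Complex.exp (-z))
  | d + 1, x, z, w =>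
      (expG d (Fin.init x) (x (Fin.last d)) w - expG d (Fin.init x) (x (Fin.last d) + z) w) /
        (1 - Complex.exp (-z))

theorem exp_neg_ofReal_ne_one {x : ℝ} (hx : 0 < x) : Complex.exp (-(x : ℂ)) ≠ 1 := by
  rw [← Complex.ofReal_neg, ← Complex.ofReal_exp]
  norm_cast
  exact (Real.exp_lt_one_iff.2 (by linarith)).ne

theorem exp_neg_ofReal_cpow (x : ℝ) (w : ℂ) :
    Complex.exp (-(x : ℂ)) ^ w = Complex.exp (-(w * x)) := by
  rw [Complex.cpow_def_of_ne_zero (Complex.exp_ne_zero _), ← Complex.ofReal_neg,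
    ← Complex.ofReal_exp, ← Complex.ofReal_log (Real.exp_pos _).le, Real.log_exp]
  congr 1
  push_cast
  ring

/-- For positive coordinates no `q_m` equals `1`, so the derivative branch of `G` never occurs, and
multiplying the last two entries of `q` adds exponents. -/
theorem G_exp_snoc (w : ℂ) : ∀ (d : ℕ) (x : Fin d → ℝ) (z : ℝ), (∀ m, 0 < x m) → 0 < z →
    G (d + 1) (fun m => Complex.exp (-((Fin.snoc x z : Fin (d + 1) → ℝ) m : ℂ))) w =
      expG d x z w
  | 0, x, z, _, hz => by
    have h0 : (Fin.snoc x z : Fin 1 → ℝ) 0 = z := rfl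
    simp only [G, expG, h0]
    rw [if_neg (exp_neg_ofReal_ne_one hz), exp_neg_ofReal_cpow]
  | d + 1, x, z, hx, hz => by
    have hlast : (Fin.snoc x z : Fin (d + 2) → ℝ) (Fin.last (d + 1)) = z := Fin.snoc_last _ _
    have hinit : (Fin.init fun m => Complex.exp (-((Fin.snoc x z : Fin (d + 2) → ℝ) m : ℂ))) =
        fun m => Complex.exp (-((Fin.snoc (Fin.init x) (x (Fin.last d)) : Fin (d + 1) → ℝ) m : ℂ)) := by
      funext m
      simp [Fin.init]
    have hupd : Function.update
        (Fin.init fun m => Complex.exp (-((Fin.snoc x z : Fin (d + 2) → ℝ) m : ℂ))) (Fin.last d)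
        ((Fin.init fun m => Complex.exp (-((Fin.snoc x z : Fin (d + 2) → ℝ) m : ℂ))) (Fin.last d) *
          Complex.exp (-(z : ℂ))) =
        fun m => Complex.exp
          (-((Fin.snoc (Fin.init x) (x (Fin.last d) + z) : Fin (d + 1) → ℝ) m : ℂ)) := by
      funext m
      refine Fin.lastCases ?_ (fun m => ?_) m
      · rw [Function.update_self, hinit]
        simp only [Fin.snoc_last]
        rw [← Complex.exp_add]
        push_cast
        ring_nf
      · rw [Function.update_of_ne (Fin.castSucc_lt_last m).ne, hinit]
        simp
    have ih1 := G_exp_snoc w d (Fin.init x) (x (Fin.last d)) (fun m => hx _) (hx _)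
    have ih2 := G_exp_snoc w d (Fin.init x) (x (Fin.last d) + z) (fun m => hx _)
      (add_pos (hx _) hz)
    rw [G, hlast, if_neg (exp_neg_ofReal_ne_one hz), hupd, hinit, ih1, ih2, expG]
    push_cast
    ring

theorem G_exp (d : ℕ) (x : Fin (d + 1) → ℝ) (hx : ∀ m, 0 < x m) (w : ℂ) :
    G (d + 1) (fun m => Complex.exp (-(x m : ℂ))) w =
      expG d (Fin.init x) (x (Fin.last d)) w := by
  conv_lhs => rw [← Fin.snoc_init_self x]
  exact G_exp_snoc w d _ _ (fun m => hx _) (hx _)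

theorem measurable_expG (w : ℂ) : ∀ d : ℕ,
    Measurable fun p : (Fin d → ℝ) × ℂ => expG d p.1 p.2 w
  | 0 => by
    simp only [expG]
    fun_prop
  | d + 1 => by
    have ih := measurable_expG w d
    have hinit : Measurable fun p : (Fin (d + 1) → ℝ) × ℂ => (Fin.init p.1 : Fin d → ℝ) :=
      measurable_pi_lambda _ fun m => (measurable_pi_apply _).comp measurable_fst
    have hl : Measurable fun p : (Fin (d + 1) → ℝ) × ℂ => (p.1 (Fin.last d) : ℂ) :=
      Complex.measurable_ofReal.comp ((measurable_pi_apply _).comp measurable_fst)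
    have h1 := ih.comp (hinit.prodMk hl)
    have h2 := ih.comp (hinit.prodMk (hl.add measurable_snd))
    simp only [expG]
    exact (h1.sub h2).div (by fun_prop)

theorem differentiable_expG : ∀ (d : ℕ) (x : Fin d → ℝ) (z : ℂ),
    Differentiable ℂ fun w => expG d x z w
  | 0, _, _ => by
    simp only [expG]
    fun_prop
  | d + 1, x, z => by
    simp only [expG]
    exact ((differentiable_expG d _ _).sub (differentiable_expG d _ _)).div_const _

/-! ### A bound with simple poles, uniform in the argument. -/

/-- One factor of a bound for `G(e^{-x}; u)`, valid for all `u` with `-a ≤ Re u`. -/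
noncomputable def poleFactor (a y : ℝ) : ℝ := 2 * Real.exp (a * y) / (1 - Real.exp (-y))

theorem one_sub_exp_neg_pos {y : ℝ} (hy : 0 < y) : 0 < 1 - Real.exp (-y) := by
  have : Real.exp (-y) < 1 := Real.exp_lt_one_iff.2 (by linarith)
  linarith

theorem norm_one_sub_exp_neg {y : ℝ} (hy : 0 < y) :
    ‖1 - Complex.exp (-(y : ℂ))‖ = 1 - Real.exp (-y) := by
  rw [← Complex.ofReal_neg, ← Complex.ofReal_exp, ← Complex.ofReal_one, ← Complex.ofReal_sub,
    Complex.norm_real, Real.norm_of_nonneg (one_sub_exp_neg_pos hy).le]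

theorem poleFactor_nonneg {a y : ℝ} (hy : 0 < y) : 0 ≤ poleFactor a y :=
  div_nonneg (by positivity) (one_sub_exp_neg_pos hy).le

theorem norm_expG_le_prod_poleFactor {a : ℝ} (ha : 0 ≤ a) {u : ℂ} (hu : -a ≤ u.re) :
    ∀ (d : ℕ) (x : Fin d → ℝ) (z : ℝ), (∀ m, 0 < x m) → 0 < z →
      ‖expG d x z u‖ ≤ (∏ m, poleFactor a (x m)) * poleFactor a z
  | 0, x, z, _, hz => by
    simp only [expG, Finset.univ_eq_empty, Finset.prod_empty, one_mul, poleFactor]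
    rw [norm_div, norm_one_sub_exp_neg hz]
    refine div_le_div_of_nonneg_right ?_ (one_sub_exp_neg_pos hz).le
    have h1 : ‖Complex.exp (-(u * z))‖ ≤ Real.exp (a * z) := by
      rw [Complex.norm_exp]
      simp only [Complex.neg_re, Complex.mul_re, Complex.ofReal_re, Complex.ofReal_im, mul_zero,
        sub_zero]
      gcongr
      nlinarith
    have h2 : 1 ≤ Real.exp (a * z) := Real.one_le_exp (by positivity)
    have := norm_sub_le 1 (Complex.exp (-(u * z)))
    rw [norm_one] at this
    linarith
  | d + 1, x, z, hx, hz => by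
    have hl := hx (Fin.last d)
    have ih1 := norm_expG_le_prod_poleFactor ha hu d (Fin.init x) (x (Fin.last d))
      (fun m => hx _) hl
    have ih2 := norm_expG_le_prod_poleFactor ha hu d (Fin.init x) (x (Fin.last d) + z)
      (fun m => hx _) (add_pos hl hz)
    have hP : 0 ≤ ∏ m, poleFactor a ((Fin.init x : Fin d → ℝ) m) :=
      Finset.prod_nonneg fun m _ => poleFactor_nonneg (hx _)
    have he : 1 ≤ Real.exp (a * z) := Real.one_le_exp (by positivity)
    -- Shifting by `z` only enlarges the denominator, so it costs at most `e^{az}`; the factor `2`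
    -- in `poleFactor a z` pays for the two terms of the difference.
    have hmono : poleFactor a (x (Fin.last d) + z) ≤
        poleFactor a (x (Fin.last d)) * Real.exp (a * z) := by
      unfold poleFactor
      rw [mul_add, Real.exp_add, div_mul_eq_mul_div, ← mul_assoc]
      refine div_le_div_of_nonneg_left (by positivity) (one_sub_exp_neg_pos hl) ?_
      have : Real.exp (-(x (Fin.last d) + z)) ≤ Real.exp (-x (Fin.last d)) :=
        Real.exp_le_exp.2 (by linarith)
      linarith
    rw [Fin.prod_univ_castSucc]
    change ‖(expG d (Fin.init x) (x (Fin.last d)) u -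
      expG d (Fin.init x) (x (Fin.last d) + z) u) / (1 - Complex.exp (-z))‖ ≤
      (∏ m, poleFactor a ((Fin.init x : Fin d → ℝ) m)) * poleFactor a (x (Fin.last d)) *
        poleFactor a z
    push_cast at ih2
    set P := ∏ m, poleFactor a ((Fin.init x : Fin d → ℝ) m)
    have hp := poleFactor_nonneg (a := a) hl
    rw [norm_div, norm_one_sub_exp_neg hz, poleFactor.eq_1 a z, ← mul_div_assoc]
    refine div_le_div_of_nonneg_right ?_ (one_sub_exp_neg_pos hz).le
    refine (norm_sub_le _ _).trans ?_
    have h1 : P * poleFactor a (x (Fin.last d)) ≤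
        P * (poleFactor a (x (Fin.last d)) * Real.exp (a * z)) := by
      gcongr
      exact le_mul_of_one_le_right hp he
    have h2 : P * poleFactor a (x (Fin.last d) + z) ≤
        P * (poleFactor a (x (Fin.last d)) * Real.exp (a * z)) := by
      gcongr
    linarith

/-! ### Cancellation of the poles on a half-strip. -/

/-- A half-strip around `[0, ∞)`. -/
def halfStrip : Set ℂ := {z | -(1 / 4) < z.re ∧ |z.im| < 1 / 4}

theorem isOpen_halfStrip : IsOpen halfStrip :=
  (isOpen_lt continuous_const Complex.continuous_re).inter
    (isOpen_lt (continuous_abs.comp Complex.continuous_im) continuous_const)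

theorem ball_subset_halfStrip : Metric.ball (0 : ℂ) (1 / 4) ⊆ halfStrip := by
  intro z hz
  rw [mem_ball_zero_iff] at hz
  have h1 := Complex.abs_re_le_norm z
  have h2 := Complex.abs_im_le_norm z
  exact ⟨by linarith [neg_abs_le z.re], by linarith⟩

theorem zero_mem_halfStrip : (0 : ℂ) ∈ halfStrip :=
  ball_subset_halfStrip (Metric.mem_ball_self (by norm_num))

theorem ofReal_mem_halfStrip {y : ℝ} (hy : 0 < y) : (y : ℂ) ∈ halfStrip :=
  ⟨by simp only [Complex.ofReal_re]; linarith, by simp⟩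

/-- Stability under positive translations lets the induction on `d` stay on one domain without
shrinking it. -/
theorem ofReal_add_mem_halfStrip {y : ℝ} (hy : 0 < y) {z : ℂ} (hz : z ∈ halfStrip) :
    (y : ℂ) + z ∈ halfStrip :=
  ⟨by simp only [Complex.add_re, Complex.ofReal_re]; linarith [hz.1], by simpa using hz.2⟩

theorem half_norm_le_norm_one_sub_exp_neg {z : ℂ} (hz : ‖z‖ ≤ 1 / 2) :
    ‖z‖ / 2 ≤ ‖1 - Complex.exp (-z)‖ := by
  have h := Complex.norm_exp_sub_one_sub_id_le (x := -z) (by rw [norm_neg]; linarith)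
  rw [norm_neg] at h
  have h2 : ‖z‖ ≤ ‖1 - Complex.exp (-z)‖ + ‖Complex.exp (-z) - 1 - -z‖ := by
    refine le_trans (le_of_eq ?_) (norm_add_le _ _)
    congr 1
    ring
  nlinarith [norm_nonneg z]

/-- The only zero of `1 - e^{-z}` in the half-strip is `0`. Points with `‖z‖ ≥ 1/2` have `Re z ≥
1/4`, since `|Im z| < 1/4`, and `e^{1/4} ≥ 5/4` bounds the exponential by `4/5`. -/
theorem le_norm_one_sub_exp_neg {z : ℂ} (hz : z ∈ halfStrip) (h : 1 / 4 ≤ ‖z‖) :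
    1 / 8 ≤ ‖1 - Complex.exp (-z)‖ := by
  rcases le_total ‖z‖ (1 / 2) with h2 | h2
  · linarith [half_norm_le_norm_one_sub_exp_neg h2]
  · have hre : 1 / 4 ≤ z.re := by
      have h3 := Complex.norm_le_abs_re_add_abs_im z
      by_contra hlt
      have := hz.2
      have := hz.1
      have : |z.re| < 1 / 4 := abs_lt.2 ⟨this, not_le.1 hlt⟩
      linarith
    have h4 : ‖Complex.exp (-z)‖ ≤ 4 / 5 := by
      rw [Complex.norm_exp, Complex.neg_re, Real.exp_neg]
      have := Real.add_one_le_exp z.re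
      rw [inv_le_comm₀ (Real.exp_pos _) (by norm_num)]
      norm_num
      linarith
    have := norm_sub_norm_le 1 (Complex.exp (-z))
    rw [norm_one] at this
    linarith

/-- Both `k` and `1 - e^{-z}` vanish at `0`, so the quotient of their slopes from `0` removes the
singularity; the second slope has no zero in the half-strip. -/
theorem exists_div_one_sub_exp_neg {a M : ℝ} (ha : 0 ≤ a) (ha1 : a ≤ 1) {k : ℂ → ℂ}
    (hk : DifferentiableOn ℂ k halfStrip) (hk0 : k 0 = 0)
    (hb : ∀ z ∈ halfStrip, ‖k z‖ ≤ M * Real.exp (a * z.re)) :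
    ∃ h : ℂ → ℂ, DifferentiableOn ℂ h halfStrip ∧
      (∀ z ∈ halfStrip, ‖h z‖ ≤ 8 * Real.exp 1 * M * Real.exp (a * z.re)) ∧
      ∀ z : ℂ, z ≠ 0 → h z = k z / (1 - Complex.exp (-z)) := by
  set u : ℂ → ℂ := fun z => 1 - Complex.exp (-z) with hu_def
  have hu : Differentiable ℂ u := by fun_prop
  have hu0 : u 0 = 0 := by simp [hu_def]
  have hnhds : halfStrip ∈ 𝓝 (0 : ℂ) := isOpen_halfStrip.mem_nhds zero_mem_halfStrip
  have hM : 0 ≤ M := by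
    have := (norm_nonneg _).trans (hb 0 zero_mem_halfStrip)
    simpa using this
  have hslope : ∀ (f : ℂ → ℂ), f 0 = 0 → ∀ z ≠ 0, dslope f 0 z = f z / z := by
    intro f hf z hz
    rw [dslope_of_ne _ hz, slope_def_field, hf, sub_zero, sub_zero]
  have hderiv : deriv u 0 = 1 := by
    have : HasDerivAt u (-(Complex.exp (-0) * -1)) 0 :=
      ((hasDerivAt_neg (0 : ℂ)).cexp).const_sub 1
    simpa using this.deriv
  have hsmall : ∀ z : ℂ, ‖z‖ ≤ 1 / 2 → 1 / 2 ≤ ‖dslope u 0 z‖ := by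
    intro z hz
    rcases eq_or_ne z 0 with rfl | h0
    · rw [dslope_same, hderiv, norm_one]; norm_num
    · rw [hslope u hu0 z h0, norm_div, le_div_iff₀ (norm_pos_iff.2 h0)]
      linarith [half_norm_le_norm_one_sub_exp_neg hz]
  have hne : ∀ z ∈ halfStrip, dslope u 0 z ≠ 0 := by
    intro z hz
    rcases le_total ‖z‖ (1 / 2) with h | h
    · rw [← norm_pos_iff]; linarith [hsmall z h]
    · have h0 : z ≠ 0 := by rw [← norm_pos_iff]; linarith
      rw [hslope u hu0 z h0]
      refine div_ne_zero ?_ h0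
      rw [← norm_pos_iff]
      linarith [le_norm_one_sub_exp_neg hz (by linarith)]
  have hval : ∀ z : ℂ, z ≠ 0 → dslope k 0 z / dslope u 0 z = k z / u z := by
    intro z hz
    rw [hslope u hu0 z hz, hslope k hk0 z hz, div_div_div_cancel_right₀ hz]
  refine ⟨fun z => dslope k 0 z / dslope u 0 z, ?_, ?_, hval⟩
  · exact ((Complex.differentiableOn_dslope hnhds).2 hk).div
      ((Complex.differentiableOn_dslope hnhds).2 hu.differentiableOn) hne
  · intro z hz
    rcases lt_or_ge ‖z‖ (1 / 4) with h | h
    · have hmaps : Set.MapsTo k (Metric.ball 0 (1 / 4))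
          (Metric.closedBall (k 0) (M * Real.exp (1 / 4))) := by
        intro y hy
        rw [hk0, mem_closedBall_zero_iff]
        refine (hb y (ball_subset_halfStrip hy)).trans ?_
        have hy' : y.re ≤ 1 / 4 :=
          (Complex.re_le_norm y).trans (mem_ball_zero_iff.1 hy).le
        gcongr
        nlinarith
      have h1 := Complex.norm_dslope_le_div_of_mapsTo_ball (hk.mono ball_subset_halfStrip) hmaps
        (mem_ball_zero_iff.2 h)
      have h2 := hsmall z (by linarith)
      have h3 : Real.exp (1 / 4) ≤ Real.exp 1 * Real.exp (a * z.re) := by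
        rw [← Real.exp_add]
        gcongr
        have := hz.1
        nlinarith
      rw [norm_div, div_le_iff₀ (by linarith)]
      have h4 : M * Real.exp (1 / 4) / (1 / 4) =
          8 * (M * Real.exp (1 / 4)) * (1 / 2) := by ring
      rw [h4] at h1
      refine h1.trans ?_
      refine mul_le_mul ?_ h2 (by norm_num) (by positivity)
      nlinarith [mul_le_mul_of_nonneg_left h3 hM]
    · have h0 : z ≠ 0 := by rw [← norm_pos_iff]; linarith
      have h1 := le_norm_one_sub_exp_neg hz h
      change ‖dslope k 0 z / dslope u 0 z‖ ≤ _
      rw [hval z h0, norm_div, div_le_iff₀ (by change 0 < ‖1 - Complex.exp (-z)‖; linarith)]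
      refine (hb z hz).trans ?_
      have he : 1 ≤ Real.exp 1 := Real.one_le_exp zero_le_one
      calc M * Real.exp (a * z.re) = 8 * 1 * M * Real.exp (a * z.re) * (1 / 8) := by ring
        _ ≤ 8 * Real.exp 1 * M * Real.exp (a * z.re) * ‖u z‖ := by gcongr

/-- The constant must not depend on `x` or `w`. Dependence on `x` enters only through `e^{a ∑ x_m}`,
which is what evaluating the previous extension at `y` and `y + z` produces. -/
theorem exists_holomorphic_expG {a M : ℝ} (ha : 0 ≤ a) (ha1 : a ≤ 1) : ∀ d : ℕ,
    ∃ C : ℝ, ∀ w : ℂ, ‖w‖ ≤ M → -a ≤ w.re → ∀ x : Fin d → ℝ, (∀ m, 0 < x m) →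
      ∃ h : ℂ → ℂ, DifferentiableOn ℂ h halfStrip ∧
        (∀ z ∈ halfStrip, ‖h z‖ ≤ C * Real.exp (a * ∑ m, x m) * Real.exp (a * z.re)) ∧
        ∀ z : ℝ, 0 < z → h z = expG d x z w
  | 0 => by
    refine ⟨8 * Real.exp 1 * (2 * Real.exp (M + 1)), fun w hw hwa x _ => ?_⟩
    have hk : ∀ z ∈ halfStrip,
        ‖1 - Complex.exp (-(w * z))‖ ≤ 2 * Real.exp (M + 1) * Real.exp (a * z.re) := by
      intro z hz
      have hM : 0 ≤ M := (norm_nonneg w).trans hw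
      have hre : |w.re| ≤ M := (Complex.abs_re_le_norm w).trans hw
      have him : |w.im| ≤ M := (Complex.abs_im_le_norm w).trans hw
      -- For `Re z ≥ 0` the condition `-a ≤ Re w` controls the growth. For `Re z < 0` one has `|Re
      -- z| < 1/4`, so the constant `M + 1` suffices.
      have h1 : (-(w * z)).re ≤ M + 1 + a * z.re := by
        have h2 : w.im * z.im ≤ M * (1 / 4) := by
          refine (le_abs_self _).trans ?_
          rw [abs_mul]
          exact mul_le_mul him hz.2.le (abs_nonneg _) hM
        have h3 : -(w.re * z.re) ≤ M / 4 + 1 + a * z.re := by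
          rcases le_total 0 z.re with h | h
          · nlinarith
          · have h5 := hz.1
            have h6 := (abs_le.1 hre).2
            nlinarith
        simp only [Complex.neg_re, Complex.mul_re]
        linarith
      have h2 : ‖Complex.exp (-(w * z))‖ ≤ Real.exp (M + 1) * Real.exp (a * z.re) := by
        rw [Complex.norm_exp, ← Real.exp_add]
        exact Real.exp_le_exp.2 h1
      have h3 : 1 ≤ Real.exp (M + 1) * Real.exp (a * z.re) := by
        rw [← Real.exp_add]
        refine Real.one_le_exp ?_
        have := hz.1
        nlinarith
      have := norm_sub_le 1 (Complex.exp (-(w * z)))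
      rw [norm_one] at this
      linarith
    obtain ⟨h, hd, hb, he⟩ := exists_div_one_sub_exp_neg ha ha1
      (k := fun z => 1 - Complex.exp (-(w * z))) (by fun_prop) (by simp) hk
    refine ⟨h, hd, fun z hz => by simpa using hb z hz, fun z hz => ?_⟩
    rw [he z (by exact_mod_cast hz.ne')]
    rfl
  | d + 1 => by
    obtain ⟨C, hC⟩ := exists_holomorphic_expG ha ha1 d
    refine ⟨8 * Real.exp 1 * (C * (1 + Real.exp 1)), fun w hw hwa x hx => ?_⟩
    obtain ⟨g, hgd, hgb, hge⟩ := hC w hw hwa (Fin.init x) (fun m => hx _)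
    have hy := hx (Fin.last d)
    set y := x (Fin.last d) with hy_def
    have hgy := hgb y (ofReal_mem_halfStrip hy)
    have hsum : ∑ m, x m = ∑ m, (Fin.init x : Fin d → ℝ) m + y := Fin.sum_univ_castSucc x
    rw [mul_assoc, ← Real.exp_add, Complex.ofReal_re, ← mul_add, ← hsum] at hgy
    have hC0 : 0 ≤ C * Real.exp (a * ∑ m, x m) := (norm_nonneg _).trans hgy
    have hkd : DifferentiableOn ℂ (fun z => g y - g (y + z)) halfStrip := by
      refine (differentiableOn_const _).sub (hgd.comp (by fun_prop) fun z hz => ?_)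
      exact ofReal_add_mem_halfStrip hy hz
    have hk : ∀ z ∈ halfStrip, ‖g y - g (y + z)‖ ≤
        C * Real.exp (a * ∑ m, x m) * (1 + Real.exp 1) * Real.exp (a * z.re) := by
      intro z hz
      have h1 := hgb _ (ofReal_add_mem_halfStrip hy hz)
      rw [Complex.add_re, Complex.ofReal_re, mul_add, Real.exp_add, ← mul_assoc,
        mul_assoc C, ← Real.exp_add, ← mul_add, ← hsum] at h1
      refine (norm_sub_le _ _).trans ?_
      have h3 : 1 ≤ Real.exp 1 * Real.exp (a * z.re) := by
        rw [← Real.exp_add]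
        refine Real.one_le_exp ?_
        have := hz.1
        nlinarith
      nlinarith [mul_le_mul_of_nonneg_left h3 hC0]
    obtain ⟨h, hd, hb, he⟩ := exists_div_one_sub_exp_neg ha ha1 hkd (by simp) hk
    refine ⟨h, hd, fun z hz => (hb z hz).trans (le_of_eq ?_), fun z hz => ?_⟩
    · ring
    · rw [he z (by exact_mod_cast hz.ne'), hge y hy, expG]
      have := hge (y + z) (add_pos hy hz)
      push_cast at this
      rw [this]

theorem exists_norm_expG_le {a : ℝ} (M : ℝ) (ha : 0 ≤ a) (ha1 : a ≤ 1) (d : ℕ) :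
    ∃ C : ℝ, ∀ w : ℂ, ‖w‖ ≤ M → -a ≤ w.re → ∀ x : Fin d → ℝ, (∀ m, 0 < x m) → ∀ z : ℝ, 0 < z →
      ‖expG d x z w‖ ≤ C * Real.exp (a * (∑ m, x m + z)) := by
  obtain ⟨C, hC⟩ := exists_holomorphic_expG (M := M) ha ha1 d
  refine ⟨C, fun w hw hwa x hx z hz => ?_⟩
  obtain ⟨h, -, hb, he⟩ := hC w hw hwa x hx
  have := hb z (ofReal_mem_halfStrip hz)
  rwa [he z hz, mul_assoc, ← Real.exp_add, Complex.ofReal_re, ← mul_add] at this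

/-! ### Series expansion in the first variable. -/

theorem hasSum_exp_sub_exp (w : ℂ) {z : ℂ} (hz : 0 < z.re) :
    HasSum (fun j : ℕ => Complex.exp (-(j * z)) - Complex.exp (-((w + j) * z)))
      ((1 - Complex.exp (-(w * z))) / (1 - Complex.exp (-z))) := by
  have hlt : ‖Complex.exp (-z)‖ < 1 := by
    rw [Complex.norm_exp, Complex.neg_re]
    exact Real.exp_lt_one_iff.2 (by linarith)
  have h := (hasSum_geometric_of_norm_lt_one hlt).mul_left (1 - Complex.exp (-(w * z)))
  rw [← div_eq_mul_inv] at h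
  refine h.congr_fun fun j => ?_
  rw [← Complex.exp_nat_mul, sub_mul, one_mul, ← Complex.exp_add]
  congr 2 <;> ring

/-- The series acts on the first variable and the recursion on the last, so the series for `d + 1`
is the divided difference of two series for `d`. In the base case these are geometric, with ratios
`e^{-x_0}` and `e^{-(x_0 + z)}`. -/
theorem hasSum_expG (w : ℂ) : ∀ (d : ℕ) (x : Fin (d + 1) → ℝ) (z : ℝ), (∀ m, 0 < x m) → 0 < z →
    HasSum (fun j : ℕ => Complex.exp (-(j * x 0)) * expG d (Fin.tail x) z j -
      Complex.exp (-((w + j) * x 0)) * expG d (Fin.tail x) z (w + j)) (expG (d + 1) x z w)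
  | 0, x, z, hx, hz => by
    have h1 := hasSum_exp_sub_exp w (z := (x 0 : ℂ)) (by simpa using hx 0)
    have h2 := hasSum_exp_sub_exp w (z := (x 0 : ℂ) + z)
      (by simpa using add_pos (hx 0) hz)
    refine ((h1.sub h2).div_const (1 - Complex.exp (-(z : ℂ)))).congr_fun fun j => ?_
    simp only [expG]
    rw [mul_div_assoc', mul_div_assoc', ← sub_div]
    congr 1
    rw [mul_sub, mul_sub, ← Complex.exp_add, ← Complex.exp_add]
    ring_nf
  | d + 1, x, z, hx, hz => by
    have hl := hx (Fin.last (d + 1))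
    have h1 := hasSum_expG w d (Fin.init x) (x (Fin.last (d + 1))) (fun m => hx _) hl
    have h2 := hasSum_expG w d (Fin.init x) (x (Fin.last (d + 1)) + z) (fun m => hx _)
      (add_pos hl hz)
    push_cast at h2
    refine ((h1.sub h2).div_const (1 - Complex.exp (-(z : ℂ)))).congr_fun fun j => ?_
    have h0 : (Fin.init x : Fin (d + 1) → ℝ) 0 = x 0 := rfl
    have ht : (Fin.tail x : Fin (d + 1) → ℝ) (Fin.last d) = x (Fin.last (d + 1)) := rfl
    rw [h0, Fin.tail_init_eq_init_tail]
    rw [expG, expG, ht]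
    ring

/-! ### The Mellin integrand: norm, measurability, holomorphy. -/

theorem measurableSet_openOrthant (d : ℕ) : MeasurableSet (openOrthant d) :=
  MeasurableSet.univ_pi fun _ => measurableSet_Ioi

theorem mem_openOrthant {d : ℕ} {x : Fin d → ℝ} : x ∈ openOrthant d ↔ ∀ m, 0 < x m := by
  simp [openOrthant]

theorem mem_openCube {d : ℕ} {x : Fin d → ℝ} : x ∈ openCube d ↔ ∀ m, 0 < x m ∧ x m < 1 := by
  simp [openCube]

theorem norm_mellinIntegrand {d : ℕ} (p : (Fin d → ℂ) × ℂ) {x : Fin d → ℝ}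
    (hx : x ∈ openOrthant d) :
    ‖mellinIntegrand d p x‖ = ‖G d (fun m => Complex.exp (-(x m : ℂ))) p.2‖ *
      ∏ m, (x m ^ ((p.1 m).re - 1) * Real.exp (-x m)) := by
  rw [mellinIntegrand, norm_mul, norm_prod]
  congr 1
  refine Finset.prod_congr rfl fun m _ => ?_
  have := norm_ofReal_cpow_mul_exp (a := p.1 m) (r := 1) (mem_openOrthant.1 hx m)
  simpa using this

theorem aestronglyMeasurable_mellinIntegrand (d : ℕ) (p : (Fin d → ℂ) × ℂ) :
    AEStronglyMeasurable (mellinIntegrand d p) (volume.restrict (openOrthant d)) := by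
  have hprod : AEStronglyMeasurable
      (fun x : Fin d → ℝ => ∏ m, ((x m : ℂ) ^ (p.1 m - 1) * Complex.exp (-(x m : ℂ))))
      (volume.restrict (openOrthant d)) := by
    refine Measurable.aestronglyMeasurable ?_
    fun_prop
  refine AEStronglyMeasurable.mul ?_ hprod
  cases d with
  | zero =>
    simp only [G]
    exact aestronglyMeasurable_const
  | succ d =>
    have hinit : Measurable fun x : Fin (d + 1) → ℝ => (Fin.init x : Fin d → ℝ) :=
      measurable_pi_lambda _ fun m => measurable_pi_apply _
    have hl : Measurable fun x : Fin (d + 1) → ℝ => (x (Fin.last d) : ℂ) :=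
      Complex.measurable_ofReal.comp (measurable_pi_apply _)
    refine ((measurable_expG p.2 d).comp (hinit.prodMk hl)).aestronglyMeasurable.congr ?_
    filter_upwards [ae_restrict_mem (measurableSet_openOrthant _)] with x hx
    exact (G_exp d x (mem_openOrthant.1 hx) p.2).symm

theorem differentiable_mellinIntegrand {d : ℕ} {x : Fin d → ℝ} (hx : x ∈ openOrthant d) :
    Differentiable ℂ fun p => mellinIntegrand d p x := by
  have hG : Differentiable ℂ fun w => G d (fun m => Complex.exp (-(x m : ℂ))) w := by
    cases d with
    | zero =>
      simp only [G]
      fun_prop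
    | succ d =>
      simp only [G_exp d x (mem_openOrthant.1 hx)]
      exact differentiable_expG d _ _
  have hne : ∀ m, (x m : ℂ) ≠ 0 := fun m => by exact_mod_cast (mem_openOrthant.1 hx m).ne'
  unfold mellinIntegrand
  refine (hG.comp differentiable_snd).mul ?_
  have hm : ∀ m, Differentiable ℂ fun p : (Fin d → ℂ) × ℂ =>
      (x m : ℂ) ^ (p.1 m - 1) * Complex.exp (-(x m : ℂ)) := fun m =>
    (Differentiable.const_cpow (by fun_prop) (Or.inl (hne m))).mul_const _
  exact fun p => (HasFDerivAt.finsetProd fun m _ => (hm m p).hasFDerivAt).differentiableAt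

theorem norm_G_le_prod_poleFactor {a : ℝ} (ha : 0 ≤ a) {u : ℂ} (hu : -a ≤ u.re) {d : ℕ}
    {x : Fin d → ℝ} (hx : x ∈ openOrthant d) :
    ‖G d (fun m => Complex.exp (-(x m : ℂ))) u‖ ≤ ∏ m, poleFactor a (x m) := by
  rw [mem_openOrthant] at hx
  cases d with
  | zero => simp [G]
  | succ d =>
    rw [G_exp d x hx, Fin.prod_univ_castSucc]
    exact norm_expG_le_prod_poleFactor ha hu d _ _ (fun m => hx _) (hx _)

theorem exists_norm_G_le {a : ℝ} (M : ℝ) (ha : 0 ≤ a) (ha1 : a ≤ 1) (d : ℕ) :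
    ∃ C : ℝ, ∀ w : ℂ, ‖w‖ ≤ M → -a ≤ w.re → ∀ x ∈ openOrthant d,
      ‖G d (fun m => Complex.exp (-(x m : ℂ))) w‖ ≤ C * Real.exp (a * ∑ m, x m) := by
  cases d with
  | zero => exact ⟨1, fun w _ _ x _ => by simp [G]⟩
  | succ d =>
    obtain ⟨C, hC⟩ := exists_norm_expG_le M ha ha1 d
    refine ⟨C, fun w hw hwa x hx => ?_⟩
    rw [mem_openOrthant] at hx
    rw [G_exp d x hx, Fin.sum_univ_castSucc]
    exact hC w hw hwa _ (fun m => hx _) _ (hx _)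

theorem hasSum_G (w : ℂ) (d : ℕ) {x : Fin (d + 1) → ℝ} (hx : x ∈ openOrthant (d + 1)) :
    HasSum (fun j : ℕ =>
      Complex.exp (-(j * x 0)) * G d (fun m => Complex.exp (-(Fin.tail x m : ℂ))) j -
        Complex.exp (-((w + j) * x 0)) * G d (fun m => Complex.exp (-(Fin.tail x m : ℂ))) (w + j))
      (G (d + 1) (fun m => Complex.exp (-(x m : ℂ))) w) := by
  rw [mem_openOrthant] at hx
  cases d with
  | zero =>
    have h := hasSum_exp_sub_exp w (z := (x 0 : ℂ)) (by simpa using hx 0)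
    rw [G_exp 0 x hx]
    simpa [G, expG] using h
  | succ d =>
    have h := hasSum_expG w d (Fin.init x) (x (Fin.last (d + 1))) (fun m => hx _) (hx _)
    rw [G_exp _ x hx]
    refine h.congr_fun fun j => ?_
    rw [G_exp d (Fin.tail x) (fun m => hx _), G_exp d (Fin.tail x) (fun m => hx _),
      Fin.tail_init_eq_init_tail]
    rfl

theorem integrableOn_openOrthant_prod {d : ℕ} {f : Fin d → ℝ → ℝ}
    (hf : ∀ m, IntegrableOn (f m) (Set.Ioi 0)) :
    IntegrableOn (fun x : Fin d → ℝ => ∏ m, f m (x m)) (openOrthant d) := by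
  rw [IntegrableOn, openOrthant, volume_pi, Measure.restrict_pi_pi]
  exact Integrable.fintype_prod hf

/-! ### Locally uniform domination and its consequences. -/

/-- An exhaustion of `region d 0` by bounded open sets that stay away from its boundary. -/
def subregion (d n : ℕ) : Set ((Fin d → ℂ) × ℂ) :=
  {p | (∀ m, 1 / ((n : ℝ) + 1) < (p.1 m).re ∧ (p.1 m).re < n + 1) ∧
    -1 + 1 / ((n : ℝ) + 1) < p.2.re ∧ ‖p.2‖ < n + 1}

theorem isOpen_subregion (d n : ℕ) : IsOpen (subregion d n) := by
  have h1 : ∀ m : Fin d, Continuous fun p : (Fin d → ℂ) × ℂ => (p.1 m).re := fun m =>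
    Complex.continuous_re.comp ((continuous_apply m).comp continuous_fst)
  have h2 : Continuous fun p : (Fin d → ℂ) × ℂ => p.2.re :=
    Complex.continuous_re.comp continuous_snd
  have h3 : subregion d n =
      (⋂ m, {p | 1 / ((n : ℝ) + 1) < (p.1 m).re} ∩ {p | (p.1 m).re < (n : ℝ) + 1}) ∩
        ({p | -1 + 1 / ((n : ℝ) + 1) < p.2.re} ∩ {p | ‖p.2‖ < (n : ℝ) + 1}) := by
    ext p
    simp [subregion]
  rw [h3]
  exact (isOpen_iInter_of_finite fun m =>
    (isOpen_lt continuous_const (h1 m)).inter (isOpen_lt (h1 m) continuous_const)).inter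
    ((isOpen_lt continuous_const h2).inter (isOpen_lt continuous_snd.norm continuous_const))

theorem monotone_subregion (d : ℕ) : Monotone (subregion d) := by
  intro n k h p hp
  have h1 : (n : ℝ) ≤ k := by exact_mod_cast h
  have h2 : 1 / ((k : ℝ) + 1) ≤ 1 / ((n : ℝ) + 1) := by gcongr
  exact ⟨fun m => ⟨h2.trans_lt (hp.1 m).1, (hp.1 m).2.trans_le (by linarith)⟩,
    lt_of_le_of_lt (by linarith) hp.2.1, hp.2.2.trans_le (by linarith)⟩

theorem region_subset_iUnion_subregion (d : ℕ) : region d 0 ⊆ ⋃ n, subregion d n := by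
  intro p hp
  have hsmall : ∀ r : ℝ, 0 < r → ∀ᶠ n : ℕ in atTop, 1 / ((n : ℝ) + 1) < r := fun r hr =>
    tendsto_one_div_add_atTop_nhds_zero_nat.eventually (gt_mem_nhds hr)
  have hlarge : ∀ r : ℝ, ∀ᶠ n : ℕ in atTop, r < (n : ℝ) + 1 := fun r => by
    filter_upwards [tendsto_natCast_atTop_atTop.eventually_gt_atTop r] with n hn
    linarith
  have hw : 0 < p.2.re + 1 := by have := hp.2; linarith
  obtain ⟨n, hn1, hn2, hn3⟩ := ((eventually_all.2 fun m =>
    (hsmall _ (hp.1 m)).and (hlarge (p.1 m).re)).and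
      ((hsmall _ hw).and (hlarge ‖p.2‖))).exists
  exact Set.mem_iUnion.2 ⟨n, hn1, by linarith, hn3⟩

theorem exists_subset_subregion {d : ℕ} {K : Set ((Fin d → ℂ) × ℂ)} (hK : IsCompact K)
    (hKr : K ⊆ region d 0) : ∃ n, K ⊆ subregion d n :=
  hK.elim_directed_cover _ (isOpen_subregion d) (hKr.trans (region_subset_iUnion_subregion d))
    (monotone_subregion d).directed_le

theorem rpow_le_rpow_add_rpow {x a b c : ℝ} (hx : 0 < x) (hab : a ≤ b) (hbc : b ≤ c) :
    x ^ b ≤ x ^ a + x ^ c := by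
  rcases le_total x 1 with h | h
  · have h1 := Real.rpow_le_rpow_of_exponent_ge hx h hab
    have := Real.rpow_nonneg hx.le c
    linarith
  · have h1 := Real.rpow_le_rpow_of_exponent_le h hbc
    have := Real.rpow_nonneg hx.le a
    linarith

theorem exists_bound_mellinIntegrand (d n : ℕ) :
    ∃ B : (Fin d → ℝ) → ℝ, IntegrableOn B (openOrthant d) ∧
      ∀ p ∈ subregion d n, ∀ x ∈ openOrthant d, ‖mellinIntegrand d p x‖ ≤ B x := by
  -- One `σ` bounds both `Re s_m` and `Re w + 1` from below; with `a = 1 - σ` the product `e^{ax}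
  -- e^{-x}` is the integrable `e^{-σx}`.
  set σ : ℝ := 1 / ((n : ℝ) + 1) with hσ
  have hσ0 : 0 < σ := by positivity
  have hσ1 : σ ≤ 1 := by
    rw [hσ, div_le_one (by positivity)]
    linarith [Nat.cast_nonneg (α := ℝ) n]
  obtain ⟨C, hC⟩ := exists_norm_G_le (a := 1 - σ) ((n : ℝ) + 1) (by linarith) (by linarith) d
  refine ⟨fun x => C * ∏ m, ((x m ^ (σ - 1) + x m ^ (((n : ℝ) + 1) - 1)) * Real.exp (-(σ * x m))),
    (integrableOn_openOrthant_prod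
      (f := fun _ y => (y ^ (σ - 1) + y ^ (((n : ℝ) + 1) - 1)) * Real.exp (-(σ * y)))
      fun m => ?_).const_mul C, fun p hp x hx => ?_⟩
  · simp only [add_mul]
    exact (integrableOn_rpow_mul_exp_neg_mul hσ0 hσ0).add
      (integrableOn_rpow_mul_exp_neg_mul (by positivity) hσ0)
  · have hG := hC p.2 hp.2.2.le (by linarith [hp.2.1]) x hx
    have hCe : 0 ≤ C * Real.exp ((1 - σ) * ∑ m, x m) := (norm_nonneg _).trans hG
    rw [norm_mellinIntegrand p hx]
    have hx' := mem_openOrthant.1 hx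
    calc _ ≤ C * Real.exp ((1 - σ) * ∑ m, x m) *
          ∏ m, ((x m ^ (σ - 1) + x m ^ (((n : ℝ) + 1) - 1)) * Real.exp (-x m)) := by
          refine mul_le_mul hG ?_ (Finset.prod_nonneg fun m _ => ?_) hCe
          · refine Finset.prod_le_prod (fun m _ => ?_) fun m _ => ?_
            · have := hx' m
              positivity
            · refine mul_le_mul_of_nonneg_right ?_ (Real.exp_pos _).le
              exact rpow_le_rpow_add_rpow (hx' m) (by linarith [(hp.1 m).1])
                (by linarith [(hp.1 m).2])
          · have := hx' m
            positivity
      _ = _ := by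
          rw [Finset.mul_sum, Real.exp_sum, mul_assoc, ← Finset.prod_mul_distrib]
          congr 1
          refine Finset.prod_congr rfl fun m _ => ?_
          rw [mul_left_comm, ← Real.exp_add]
          ring_nf

theorem integrableOn_mellinIntegrand {d : ℕ} {p : (Fin d → ℂ) × ℂ} (hp : p ∈ region d 0) :
    IntegrableOn (mellinIntegrand d p) (openOrthant d) := by
  obtain ⟨n, hn⟩ := Set.mem_iUnion.1 (region_subset_iUnion_subregion d hp)
  obtain ⟨B, hB, hle⟩ := exists_bound_mellinIntegrand d n
  refine hB.mono' (aestronglyMeasurable_mellinIntegrand d p) ?_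
  filter_upwards [ae_restrict_mem (measurableSet_openOrthant d)] with x hx using hle p hn x hx

theorem differentiableOn_mellinIntegral (d : ℕ) :
    DifferentiableOn ℂ (mellinIntegral d) (region d 0) := by
  intro p hp
  obtain ⟨n, hn⟩ := Set.mem_iUnion.1 (region_subset_iUnion_subregion d hp)
  obtain ⟨B, hB, hle⟩ := exists_bound_mellinIntegrand d n
  have hint : DifferentiableOn ℂ (fun p => ∫ x in openOrthant d, mellinIntegrand d p x)
      (subregion d n) := by
    refine differentiableOn_integral_of_dominated (isOpen_subregion d n)
      (fun q _ => aestronglyMeasurable_mellinIntegrand d q) ?_ hB ?_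
    · filter_upwards [ae_restrict_mem (measurableSet_openOrthant d)] with x hx
      exact (differentiable_mellinIntegrand hx).differentiableOn
    · filter_upwards [ae_restrict_mem (measurableSet_openOrthant d)] with x hx q hq
      exact hle q hq x hx
  -- `1/Γ` is entire, so the normalising factor is holomorphic everywhere.
  have hΓ : Differentiable ℂ fun p : (Fin d → ℂ) × ℂ => 1 / ∏ m, Complex.Gamma (p.1 m) := by
    simp only [one_div, ← Finset.prod_inv_distrib]
    have hm : ∀ m, Differentiable ℂ fun p : (Fin d → ℂ) × ℂ => (Complex.Gamma (p.1 m))⁻¹ :=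
      fun m => Complex.differentiable_one_div_Gamma.comp (by fun_prop)
    exact fun p => (HasFDerivAt.finsetProd fun m _ => (hm m p).hasFDerivAt).differentiableAt
  exact ((hΓ p).mul (hint.differentiableAt
    ((isOpen_subregion d n).mem_nhds hn))).differentiableWithinAt

/-- The boxes `[1/(n+1), n+1]^d` exhaust the orthant, so the integrals of `B` over their complements
tend to `0`. -/
theorem exists_isCompact_setIntegral_lt {d : ℕ} {B : (Fin d → ℝ) → ℝ}
    (hB : IntegrableOn B (openOrthant d)) {ε : ℝ} (hε : 0 < ε) :
    ∃ C ⊆ openOrthant d, IsCompact C ∧ ∫ x in openOrthant d \ C, B x < ε := by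
  set C : ℕ → Set (Fin d → ℝ) := fun n =>
    Set.pi Set.univ fun _ => Set.Icc (1 / ((n : ℝ) + 1)) ((n : ℝ) + 1) with hC
  have hcomp : ∀ n, IsCompact (C n) := fun n => isCompact_univ_pi fun _ => isCompact_Icc
  have hsub : ∀ n, C n ⊆ openOrthant d := fun n x hx => mem_openOrthant.2 fun m =>
    lt_of_lt_of_le (by positivity) (hx m trivial).1
  have hmono : Monotone C := by
    intro n k h
    have h1 : (n : ℝ) ≤ k := by exact_mod_cast h
    refine Set.pi_mono fun m _ => Set.Icc_subset_Icc ?_ (by linarith)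
    gcongr
  have hinter : ⋂ n, openOrthant d \ C n = ∅ := by
    rw [Set.eq_empty_iff_forall_notMem]
    intro x hx
    rw [Set.mem_iInter] at hx
    have hx0 := mem_openOrthant.1 (hx 0).1
    have hev : ∀ᶠ n : ℕ in atTop, ∀ m, 1 / ((n : ℝ) + 1) < x m ∧ x m < (n : ℝ) := by
      refine eventually_all.2 fun m => ?_
      exact (tendsto_one_div_add_atTop_nhds_zero_nat.eventually (gt_mem_nhds (hx0 m))).and
        (tendsto_natCast_atTop_atTop.eventually_gt_atTop _)
    obtain ⟨n, hn⟩ := hev.exists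
    exact (hx n).2 fun m _ => ⟨(hn m).1.le, by linarith [(hn m).2]⟩
  have hlim := tendsto_setIntegral_of_antitone (f := B) (μ := volume)
    (s := fun n => openOrthant d \ C n)
    (fun n => (measurableSet_openOrthant d).diff (hcomp n).measurableSet)
    (fun n k h => Set.sdiff_subset_sdiff_right (hmono h))
    ⟨0, hB.mono_set Set.sdiff_subset⟩
  rw [hinter, setIntegral_empty] at hlim
  obtain ⟨n, hn⟩ := (hlim.eventually (gt_mem_nhds hε)).exists
  exact ⟨C n, hsub n, hcomp n, hn⟩

theorem convergesAbsUniformlyOn_mellinIntegrand {d : ℕ} {K : Set ((Fin d → ℂ) × ℂ)}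
    (hK : IsCompact K) (hKr : K ⊆ region d 0) :
    ConvergesAbsUniformlyOn (mellinIntegrand d) (openOrthant d) K := by
  refine ⟨fun p hp => integrableOn_mellinIntegrand (hKr hp), fun ε hε => ?_⟩
  obtain ⟨n, hn⟩ := exists_subset_subregion hK hKr
  obtain ⟨B, hB, hle⟩ := exists_bound_mellinIntegrand d n
  obtain ⟨C, hCs, hCc, hCε⟩ := exists_isCompact_setIntegral_lt hB hε
  refine ⟨C, hCc, hCs, fun p hp => lt_of_le_of_lt ?_ hCε⟩
  refine setIntegral_mono_on
    ((integrableOn_mellinIntegrand (hKr hp)).mono_set Set.sdiff_subset).norm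
    (hB.mono_set Set.sdiff_subset)
    ((measurableSet_openOrthant d).diff hCc.measurableSet) fun x hx => hle p (hn hp) x hx.1

/-! ### Passage between the cube and the orthant. -/

/-- The coordinatewise change of variables `q = e^{-x}`. -/
noncomputable def expNeg (d : ℕ) (x : Fin d → ℝ) : Fin d → ℝ := fun m => Real.exp (-x m)

/-- The derivative of `expNeg d`. -/
noncomputable def expNegDeriv (d : ℕ) (x : Fin d → ℝ) : (Fin d → ℝ) →L[ℝ] (Fin d → ℝ) :=
  ContinuousLinearMap.pi fun m =>
    ((-Real.exp (-x m)) • ContinuousLinearMap.id ℝ ℝ) ∘SL ContinuousLinearMap.proj m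

theorem hasFDerivAt_expNeg (d : ℕ) (x : Fin d → ℝ) :
    HasFDerivAt (expNeg d) (expNegDeriv d x) x := by
  refine hasFDerivAt_pi.2 fun m => ?_
  have h := ((hasFDerivAt_apply m x).neg).exp
  refine h.congr_fderiv ?_
  ext v
  simp

theorem abs_det_expNegDeriv (d : ℕ) (x : Fin d → ℝ) :
    |(expNegDeriv d x).det| = ∏ m, Real.exp (-x m) := by
  rw [expNegDeriv, ContinuousLinearMap.det_pi, Finset.abs_prod]
  refine Finset.prod_congr rfl fun m _ => ?_
  rw [ContinuousLinearMap.det]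
  simp

theorem injective_expNeg (d : ℕ) : Function.Injective (expNeg d) := by
  intro x y h
  funext m
  have := Real.exp_injective (congrFun h m)
  linarith

theorem continuous_expNeg (d : ℕ) : Continuous (expNeg d) := by
  unfold expNeg
  fun_prop

theorem expNeg_image_openOrthant (d : ℕ) : expNeg d '' openOrthant d = openCube d := by
  ext q
  rw [mem_openCube]
  constructor
  · rintro ⟨x, hx, rfl⟩ m
    have := mem_openOrthant.1 hx m
    exact ⟨Real.exp_pos _, Real.exp_lt_one_iff.2 (by linarith)⟩
  · intro hq
    refine ⟨fun m => -Real.log (q m), mem_openOrthant.2 fun m => ?_, ?_⟩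
    · have := Real.log_neg (hq m).1 (hq m).2
      linarith
    · funext m
      simp [expNeg, Real.exp_log (hq m).1]

/-- A general measurable `S` is allowed so that complements of compact sets can be transported as
well. -/
theorem integral_image_expNeg {d : ℕ} {F : Type*} [NormedAddCommGroup F] [NormedSpace ℝ F]
    {S : Set (Fin d → ℝ)} (hS : MeasurableSet S) (g : (Fin d → ℝ) → F) :
    ∫ q in expNeg d '' S, g q = ∫ x in S, (∏ m, Real.exp (-x m)) • g (expNeg d x) := by
  rw [integral_image_eq_integral_abs_det_fderiv_smul volume hS
    (fun x _ => (hasFDerivAt_expNeg d x).hasFDerivWithinAt) (injective_expNeg d).injOn]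
  simp only [abs_det_expNegDeriv]

theorem integrableOn_image_expNeg_iff {d : ℕ} {F : Type*} [NormedAddCommGroup F]
    [NormedSpace ℝ F] {S : Set (Fin d → ℝ)} (hS : MeasurableSet S) (g : (Fin d → ℝ) → F) :
    IntegrableOn g (expNeg d '' S) ↔
      IntegrableOn (fun x => (∏ m, Real.exp (-x m)) • g (expNeg d x)) S := by
  rw [integrableOn_image_iff_integrableOn_abs_det_fderiv_smul volume hS
    (fun x _ => (hasFDerivAt_expNeg d x).hasFDerivWithinAt) (injective_expNeg d).injOn]
  simp only [abs_det_expNegDeriv]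

theorem smul_unitIntegrand_expNeg {d : ℕ} (p : (Fin d → ℂ) × ℂ) (x : Fin d → ℝ) :
    (∏ m, Real.exp (-x m)) • unitIntegrand d p (expNeg d x) = mellinIntegrand d p x := by
  simp only [unitIntegrand, mellinIntegrand, expNeg, Real.log_exp, neg_neg, Complex.real_smul]
  push_cast
  rw [Finset.prod_mul_distrib]
  ring

theorem integral_unitIntegrand (d : ℕ) (p : (Fin d → ℂ) × ℂ) :
    ∫ q in openCube d, unitIntegrand d p q = ∫ x in openOrthant d, mellinIntegrand d p x := by
  rw [← expNeg_image_openOrthant, integral_image_expNeg (measurableSet_openOrthant d)]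
  simp only [smul_unitIntegrand_expNeg]

theorem unitIntegral_eq_mellinIntegral (d : ℕ) : unitIntegral d = mellinIntegral d := by
  funext p
  rw [unitIntegral, mellinIntegral, integral_unitIntegrand]

theorem integrableOn_unitIntegrand {d : ℕ} {p : (Fin d → ℂ) × ℂ} (hp : p ∈ region d 0) :
    IntegrableOn (unitIntegrand d p) (openCube d) := by
  rw [← expNeg_image_openOrthant, integrableOn_image_expNeg_iff (measurableSet_openOrthant d)]
  simpa only [smul_unitIntegrand_expNeg] using integrableOn_mellinIntegrand hp

theorem convergesAbsUniformlyOn_unitIntegrand {d : ℕ} {K : Set ((Fin d → ℂ) × ℂ)}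
    (hK : IsCompact K) (hKr : K ⊆ region d 0) :
    ConvergesAbsUniformlyOn (unitIntegrand d) (openCube d) K := by
  refine ⟨fun p hp => integrableOn_unitIntegrand (hKr hp), fun ε hε => ?_⟩
  obtain ⟨C, hCc, hCs, hC⟩ := (convergesAbsUniformlyOn_mellinIntegrand hK hKr).2 ε hε
  refine ⟨expNeg d '' C, hCc.image (continuous_expNeg d), ?_, fun p hp => ?_⟩
  · rw [← expNeg_image_openOrthant]
    exact Set.image_mono hCs
  · rw [← expNeg_image_openOrthant, ← Set.image_sdiff (injective_expNeg d),
      integral_image_expNeg ((measurableSet_openOrthant d).diff hCc.measurableSet)]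
    convert hC p hp using 3 with x
    rw [← smul_unitIntegrand_expNeg, norm_smul, Real.norm_of_nonneg (by positivity), smul_eq_mul]

/-! ### Termwise integration and the recursion for `Ψ`. -/

theorem measurePreserving_piFinSuccAbove_openOrthant (d : ℕ) :
    MeasurePreserving (MeasurableEquiv.piFinSuccAbove (fun _ : Fin (d + 1) => ℝ) 0)
      (volume.restrict (openOrthant (d + 1)))
      ((volume.restrict (Set.Ioi 0)).prod (volume.restrict (openOrthant d))) := by
  rw [Measure.prod_restrict, ← Measure.volume_eq_prod]
  have h := (volume_preserving_piFinSuccAbove (fun _ : Fin (d + 1) => ℝ) 0).restrict_preimage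
    (measurableSet_Ioi.prod (measurableSet_openOrthant d) (s := Set.Ioi (0 : ℝ)))
  have hpre : MeasurableEquiv.piFinSuccAbove (fun _ : Fin (d + 1) => ℝ) 0 ⁻¹'
      Set.Ioi 0 ×ˢ openOrthant d = openOrthant (d + 1) := by
    ext x
    rw [mem_openOrthant, Fin.forall_fin_succ, Set.mem_preimage, Set.mem_prod, mem_openOrthant]
    rfl
  rwa [hpre] at h

theorem integrableOn_openOrthant_succ_mul {𝕜 : Type*} [RCLike 𝕜] {d : ℕ} {f : ℝ → 𝕜}
    {g : (Fin d → ℝ) → 𝕜} (hf : IntegrableOn f (Set.Ioi 0)) (hg : IntegrableOn g (openOrthant d)) :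
    IntegrableOn (fun x : Fin (d + 1) → ℝ => f (x 0) * g (Fin.tail x)) (openOrthant (d + 1)) :=
  (measurePreserving_piFinSuccAbove_openOrthant d).integrable_comp_of_integrable (hf.mul_prod hg)

theorem integral_openOrthant_succ_mul {𝕜 : Type*} [RCLike 𝕜] {d : ℕ} (f : ℝ → 𝕜)
    (g : (Fin d → ℝ) → 𝕜) :
    ∫ x : Fin (d + 1) → ℝ in openOrthant (d + 1), f (x 0) * g (Fin.tail x) =
      (∫ t in Set.Ioi 0, f t) * ∫ y in openOrthant d, g y := by
  rw [← integral_prod_mul, ← (measurePreserving_piFinSuccAbove_openOrthant d).integral_comp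
    (MeasurableEquiv.measurableEmbedding _)]
  rfl

theorem poleFactor_le {a y : ℝ} (hy : 0 < y) :
    poleFactor a y ≤ 2 * Real.exp (a * y) * (1 + y⁻¹) := by
  have h1 : y / (1 + y) ≤ 1 - Real.exp (-y) := by
    have h2 : Real.exp (-y) ≤ (1 + y)⁻¹ := by
      rw [Real.exp_neg]
      exact inv_anti₀ (by positivity) (by linarith [Real.add_one_le_exp y])
    have h3 : y / (1 + y) = 1 - (1 + y)⁻¹ := by field_simp; ring
    linarith
  have h4 : 1 + y⁻¹ = (y / (1 + y))⁻¹ := by field_simp; ring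
  rw [poleFactor, div_eq_mul_inv, h4]
  gcongr

/-- The simple pole of `poleFactor` lowers the exponent to `Re s_m - 2`, integrable at `0` because
`Re s_m > 1`. The bound `A` is independent of the size of `u`, so it serves all `u = j` and `u = w +
j` at once. -/
theorem exists_bound_mellinIntegrand_of_one_lt {d : ℕ} {s : Fin d → ℂ} (hs : ∀ m, 1 < (s m).re)
    {a : ℝ} (ha : 0 ≤ a) (ha1 : a < 1) :
    ∃ A : (Fin d → ℝ) → ℝ, IntegrableOn A (openOrthant d) ∧
      ∀ u : ℂ, -a ≤ u.re → ∀ x ∈ openOrthant d, ‖mellinIntegrand d (s, u) x‖ ≤ A x := by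
  refine ⟨fun x => ∏ m, (poleFactor a (x m) * (x m ^ ((s m).re - 1) * Real.exp (-x m))),
    integrableOn_openOrthant_prod
      (f := fun m y => poleFactor a y * (y ^ ((s m).re - 1) * Real.exp (-y))) fun m => ?_,
    fun u hu x hx => ?_⟩
  · have h1 := integrableOn_rpow_mul_exp_neg_mul (a := (s m).re) (r := 1 - a)
      (by linarith [hs m]) (by linarith)
    have h2 := integrableOn_rpow_mul_exp_neg_mul (a := (s m).re - 1) (r := 1 - a)
      (by linarith [hs m]) (by linarith)
    refine ((h1.add h2).const_mul 2).mono' ?_ ?_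
    · unfold poleFactor
      refine Measurable.aestronglyMeasurable ?_
      fun_prop
    · filter_upwards [ae_restrict_mem measurableSet_Ioi] with y hy
      have hy0 : 0 < y := hy
      have hp := poleFactor_nonneg (a := a) hy0
      rw [Real.norm_of_nonneg (by positivity)]
      refine (mul_le_mul_of_nonneg_right (poleFactor_le hy0) (by positivity)).trans (le_of_eq ?_)
      rw [Pi.add_apply, Real.rpow_sub_one hy0.ne' ((s m).re - 1),
        show -((1 - a) * y) = a * y + -y by ring, Real.exp_add]
      ring
  · rw [norm_mellinIntegrand _ hx]
    change _ ≤ ∏ m, (poleFactor a (x m) * (x m ^ ((s m).re - 1) * Real.exp (-x m)))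
    rw [Finset.prod_mul_distrib (f := fun m => poleFactor a (x m))]
    refine mul_le_mul_of_nonneg_right (norm_G_le_prod_poleFactor ha hu hx) ?_
    refine Finset.prod_nonneg fun m _ => ?_
    have := mem_openOrthant.1 hx m
    positivity

/-- The integrand for `Γ(s₁) ⋯ Γ(s_{d+1}) Ψ^d(s_2, …, s_{d+1}; u) / (u + 1)^{s₁}`. -/
noncomputable def stepIntegrand (d : ℕ) (s : Fin (d + 1) → ℂ) (u : ℂ) (x : Fin (d + 1) → ℝ) : ℂ :=
  ((x 0 : ℂ) ^ (s 0 - 1) * Complex.exp (-((u + 1) * x 0))) *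
    mellinIntegrand d (Fin.tail s, u) (Fin.tail x)

/-- The factor `e^{-x_0}` of the Mellin kernel merges with `e^{-u x_0}`, which turns `u` into `u +
1` and matches the denominators of `Ψ`. -/
theorem hasSum_stepIntegrand {d : ℕ} (s : Fin (d + 1) → ℂ) (w : ℂ) {x : Fin (d + 1) → ℝ}
    (hx : x ∈ openOrthant (d + 1)) :
    HasSum (fun j : ℕ => stepIntegrand d s j x - stepIntegrand d s (w + j) x)
      (mellinIntegrand (d + 1) (s, w) x) := by
  have h := (hasSum_G w d hx).mul_right
    (∏ m, ((x m : ℂ) ^ (s m - 1) * Complex.exp (-(x m : ℂ))))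
  refine h.congr_fun fun j => ?_
  have he : ∀ u : ℂ, Complex.exp (-((u + 1) * x 0)) =
      Complex.exp (-(u * x 0)) * Complex.exp (-(x 0 : ℂ)) := fun u => by
    rw [← Complex.exp_add]
    ring_nf
  simp only [stepIntegrand, mellinIntegrand, Fin.prod_univ_succ, he, Fin.tail]
  ring

theorem mk_mem_region_zero {d : ℕ} {s : Fin d → ℂ} {u : ℂ} (hs : ∀ m, 1 < (s m).re) (hu : -1 < u.re) :
    (s, u) ∈ region d 0 :=
  ⟨fun m => by linarith [hs m], hu⟩

theorem integrableOn_stepIntegrand {d : ℕ} {s : Fin (d + 1) → ℂ} (hs : ∀ m, 1 < (s m).re) {u : ℂ}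
    (hu : -1 < u.re) : IntegrableOn (stepIntegrand d s u) (openOrthant (d + 1)) := by
  refine integrableOn_openOrthant_succ_mul
    (integrableOn_cpow_mul_exp_neg_mul (by linarith [hs 0]) ?_)
    (integrableOn_mellinIntegrand (mk_mem_region_zero (fun m => hs m.succ) hu))
  simp only [Complex.add_re, Complex.one_re]
  linarith

theorem integral_stepIntegrand {d : ℕ} {s : Fin (d + 1) → ℂ} (hs : ∀ m, 1 < (s m).re) {u : ℂ}
    (hu : -1 < u.re) :
    ∫ x in openOrthant (d + 1), stepIntegrand d s u x =
      Complex.Gamma (s 0) / (u + 1) ^ (s 0) *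
        ∫ y in openOrthant d, mellinIntegrand d (Fin.tail s, u) y := by
  have hu' : 0 < (u + 1).re := by
    simp only [Complex.add_re, Complex.one_re]
    linarith
  rw [← integral_cpow_mul_exp_neg_mul_of_re_pos (by linarith [hs 0]) hu',
    ← integral_openOrthant_succ_mul]
  rfl

theorem integral_norm_stepIntegrand_le {d : ℕ} {s : Fin (d + 1) → ℂ} (hs : ∀ m, 1 < (s m).re)
    {a : ℝ} (ha : 0 ≤ a) (ha1 : a < 1) :
    ∃ C : ℝ, 0 ≤ C ∧ ∀ u : ℂ, ∀ r : ℝ, 0 < r → r ≤ u.re + 1 → -a ≤ u.re →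
      ∫ x in openOrthant (d + 1), ‖stepIntegrand d s u x‖ ≤ C * (1 / r ^ (s 0).re) := by
  obtain ⟨A, hA, hle⟩ := exists_bound_mellinIntegrand_of_one_lt (s := Fin.tail s)
    (fun m => hs m.succ) ha ha1
  have hs0 : 0 < (s 0).re := by linarith [hs 0]
  have hA0 : 0 ≤ ∫ y in openOrthant d, A y :=
    setIntegral_nonneg (measurableSet_openOrthant d) fun y hy =>
      (norm_nonneg _).trans (hle 0 (by simpa using ha) y hy)
  have hΓ := Real.Gamma_pos_of_pos hs0
  refine ⟨Real.Gamma (s 0).re * ∫ y in openOrthant d, A y, by positivity,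
    fun u r hr hru hua => ?_⟩
  have hu : -1 < u.re := by linarith
  have hI := integrableOn_mellinIntegrand (d := d) (p := (Fin.tail s, u))
    (mk_mem_region_zero (fun m => hs m.succ) hu)
  have h1 : ∫ x in openOrthant (d + 1), ‖stepIntegrand d s u x‖ =
      (∫ t : ℝ in Set.Ioi 0, ‖(t : ℂ) ^ (s 0 - 1) * Complex.exp (-((u + 1) * t))‖) *
        ∫ y in openOrthant d, ‖mellinIntegrand d (Fin.tail s, u) y‖ := by
    rw [← integral_openOrthant_succ_mul (𝕜 := ℝ)]
    simp only [stepIntegrand, norm_mul]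
  have h2 : ∫ t : ℝ in Set.Ioi 0, ‖(t : ℂ) ^ (s 0 - 1) * Complex.exp (-((u + 1) * t))‖ =
      (1 / (u.re + 1)) ^ (s 0).re * Real.Gamma (s 0).re := by
    rw [← Real.integral_rpow_mul_exp_neg_mul_Ioi hs0 (by linarith)]
    refine setIntegral_congr_fun measurableSet_Ioi fun t ht => ?_
    simpa using norm_ofReal_cpow_mul_exp (a := s 0) (r := u + 1) ht
  have h3 : (1 / (u.re + 1)) ^ (s 0).re ≤ 1 / r ^ (s 0).re := by
    rw [Real.div_rpow zero_le_one (by linarith), Real.one_rpow]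
    exact one_div_le_one_div_of_le (Real.rpow_pos_of_pos hr _)
      (Real.rpow_le_rpow hr.le hru hs0.le)
  have h4 : ∫ y in openOrthant d, ‖mellinIntegrand d (Fin.tail s, u) y‖ ≤
      ∫ y in openOrthant d, A y :=
    setIntegral_mono_on hI.norm hA (measurableSet_openOrthant d) (hle u hua)
  rw [h1, h2]
  calc _ ≤ (1 / r ^ (s 0).re) * Real.Gamma (s 0).re * ∫ y in openOrthant d, A y := by
        gcongr
    _ = _ := by ring

theorem hasSum_integral_stepIntegrand {d : ℕ} {s : Fin (d + 1) → ℂ} (hs : ∀ m, 1 < (s m).re)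
    {w : ℂ} (hw : -1 < w.re) :
    HasSum (fun j : ℕ => (∫ x in openOrthant (d + 1), stepIntegrand d s j x) -
        ∫ x in openOrthant (d + 1), stepIntegrand d s (w + j) x)
      (∫ x in openOrthant (d + 1), mellinIntegrand (d + 1) (s, w) x) := by
  -- This `a < 1` makes `-a` a lower bound for the real parts of both `j` and `w + j`. With `r = j +
  -- (1 - a)`, the norms are dominated by a series that converges because `Re s_0 > 1`.
  set a : ℝ := max 0 (-w.re) with ha_def
  have ha : 0 ≤ a := le_max_left _ _
  have ha1 : a < 1 := max_lt one_pos (by linarith)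
  have haw : -w.re ≤ a := le_max_right _ _
  obtain ⟨C, hC0, hC⟩ := integral_norm_stepIntegrand_le hs ha ha1
  have hI1 : ∀ j : ℕ, IntegrableOn (stepIntegrand d s j) (openOrthant (d + 1)) := fun j =>
    integrableOn_stepIntegrand hs
      (by rw [Complex.natCast_re]; linarith [Nat.cast_nonneg (α := ℝ) j])
  have hI2 : ∀ j : ℕ, IntegrableOn (stepIntegrand d s (w + j)) (openOrthant (d + 1)) := fun j =>
    integrableOn_stepIntegrand hs (by
      rw [Complex.add_re, Complex.natCast_re]; linarith [Nat.cast_nonneg (α := ℝ) j])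
  have hsum : Summable fun j : ℕ => ∫ x in openOrthant (d + 1),
      ‖stepIntegrand d s j x - stepIntegrand d s (w + j) x‖ := by
    have hz : Summable fun j : ℕ => 2 * C * (1 / |(j : ℝ) + (1 - a)| ^ (s 0).re) :=
      ((Real.summable_one_div_nat_add_rpow _ _).2 (hs 0)).mul_left _
    refine Summable.of_nonneg_of_le (fun j => integral_nonneg fun _ => norm_nonneg _)
      (fun j => ?_) hz
    have hj : (0 : ℝ) ≤ j := Nat.cast_nonneg j
    have hr : 0 < (j : ℝ) + (1 - a) := by linarith
    rw [abs_of_pos hr]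
    have h1 := hC j _ hr (by rw [Complex.natCast_re]; linarith)
      (by rw [Complex.natCast_re]; linarith)
    have h2 := hC (w + j) _ hr (by rw [Complex.add_re, Complex.natCast_re]; linarith)
      (by rw [Complex.add_re, Complex.natCast_re]; linarith)
    have h3 : ∫ x in openOrthant (d + 1), ‖stepIntegrand d s j x - stepIntegrand d s (w + j) x‖ ≤
        ∫ x in openOrthant (d + 1), (‖stepIntegrand d s j x‖ + ‖stepIntegrand d s (w + j) x‖) :=
      integral_mono ((hI1 j).sub (hI2 j)).norm ((hI1 j).norm.add (hI2 j).norm)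
        fun x => norm_sub_le _ _
    rw [integral_add (hI1 j).norm (hI2 j).norm] at h3
    linarith
  have h := hasSum_integral_of_summable_integral_norm
    (F := fun (j : ℕ) x => stepIntegrand d s j x - stepIntegrand d s (w + j) x)
    (fun j => (hI1 j).sub (hI2 j)) hsum
  have hval : ∫ x in openOrthant (d + 1), ∑' j : ℕ,
      (stepIntegrand d s j x - stepIntegrand d s (w + j) x) =
      ∫ x in openOrthant (d + 1), mellinIntegrand (d + 1) (s, w) x :=
    setIntegral_congr_fun (measurableSet_openOrthant _) fun x hx =>
      (hasSum_stepIntegrand s w hx).tsum_eq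
  rw [hval] at h
  exact h.congr_fun fun j => (integral_sub (hI1 j) (hI2 j)).symm

/-- The induction quantifies over every `w` with `Re w > -1`, since the recursion evaluates the
lower `Ψ` at `j` and `w + j`, which stay in that half-plane. -/
theorem psiConverges_and_psi_eq_mellinIntegral : ∀ (d : ℕ) (s : Fin d → ℂ) (w : ℂ),
    (∀ m, 1 < (s m).re) → -1 < w.re →
      PsiConverges d s w ∧ Psi d s w = mellinIntegral d (s, w)
  | 0, s, w, _, _ => by
    refine ⟨trivial, ?_⟩
    have hO : openOrthant 0 = Set.univ :=
      Set.eq_univ_of_forall fun x => mem_openOrthant.2 fun m => m.elim0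
    simp [Psi, mellinIntegral, mellinIntegrand, G, hO, measureReal_def, volume_pi]
  | d + 1, s, w, hs, hw => by
    have ih := psiConverges_and_psi_eq_mellinIntegral d (Fin.tail s)
    have hs' : ∀ m, 1 < (Fin.tail s m).re := fun m => hs m.succ
    have hj : ∀ j : ℕ, -1 < ((j : ℂ)).re := fun j => by
      rw [Complex.natCast_re]; linarith [Nat.cast_nonneg (α := ℝ) j]
    have hwj : ∀ j : ℕ, -1 < (w + (j : ℂ)).re := fun j => by
      rw [Complex.add_re, Complex.natCast_re]; linarith [Nat.cast_nonneg (α := ℝ) j]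
    have hΓ : Complex.Gamma (s 0) ≠ 0 := Complex.Gamma_ne_zero_of_re_pos (by linarith [hs 0])
    have hsum : HasSum (psiTerm (Psi d (Fin.tail s)) (s 0) w) (mellinIntegral (d + 1) (s, w)) := by
      -- Dividing by the full Gamma product cancels `Γ(s_0)` from Euler's integral and leaves the
      -- normalisation of the lower `Ψ`.
      refine ((hasSum_integral_stepIntegrand hs hw).mul_left
        (1 / ∏ m, Complex.Gamma (s m))).congr_fun fun j => ?_
      rw [psiTerm, (ih _ hs' (hj j)).2, (ih _ hs' (hwj j)).2, integral_stepIntegrand hs (hj j),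
        integral_stepIntegrand hs (hwj j), mellinIntegral, mellinIntegral, Fin.prod_univ_succ,
        add_assoc w]
      simp only [Fin.tail]
      field_simp
    exact ⟨⟨hsum.summable, fun j => ⟨(ih _ hs' (hj j)).1, (ih _ hs' (hwj j)).1⟩⟩, hsum.tsum_eq⟩

end MultipleHarmonic

theorem theorem4p1 (d : ℕ) :
    (∀ (s : Fin d → ℂ) (w : ℂ), (∀ m, 1 < (s m).re) → -1 < w.re →
      MultipleHarmonic.PsiConverges d s w ∧
      MultipleHarmonic.Psi d s w =
        (1 / ∏ m, Complex.Gamma (s m)) *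
          ∫ q in MultipleHarmonic.openCube d, MultipleHarmonic.unitIntegrand d (s, w) q ∧
      MultipleHarmonic.Psi d s w =
        (1 / ∏ m, Complex.Gamma (s m)) *
          ∫ x in MultipleHarmonic.openOrthant d, MultipleHarmonic.mellinIntegrand d (s, w) x) ∧
    (∀ (s : Fin d → ℂ) (w : ℂ), (∀ m, 0 < (s m).re) → -1 < w.re →
      MeasureTheory.IntegrableOn (MultipleHarmonic.unitIntegrand d (s, w))
        (MultipleHarmonic.openCube d) ∧
      MeasureTheory.IntegrableOn (MultipleHarmonic.mellinIntegrand d (s, w))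
        (MultipleHarmonic.openOrthant d)) ∧
    (∀ K : Set ((Fin d → ℂ) × ℂ), IsCompact K → K ⊆ MultipleHarmonic.region d 0 →
      MultipleHarmonic.ConvergesAbsUniformlyOn (MultipleHarmonic.unitIntegrand d)
        (MultipleHarmonic.openCube d) K ∧
      MultipleHarmonic.ConvergesAbsUniformlyOn (MultipleHarmonic.mellinIntegrand d)
        (MultipleHarmonic.openOrthant d) K) ∧
    DifferentiableOn ℂ (MultipleHarmonic.unitIntegral d) (MultipleHarmonic.region d 0) ∧
    DifferentiableOn ℂ (MultipleHarmonic.mellinIntegral d) (MultipleHarmonic.region d 0) ∧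
    Set.EqOn (MultipleHarmonic.unitIntegral d) (fun p => MultipleHarmonic.Psi d p.1 p.2)
      (MultipleHarmonic.region d 1) := by
  have hpsi := MultipleHarmonic.psiConverges_and_psi_eq_mellinIntegral d
  have hreg : ∀ (s : Fin d → ℂ) (w : ℂ), (∀ m, 0 < (s m).re) → -1 < w.re →
      (s, w) ∈ MultipleHarmonic.region d 0 := fun s w hs hw => ⟨hs, hw⟩
  refine ⟨fun s w hs hw => ⟨(hpsi s w hs hw).1, ?_, (hpsi s w hs hw).2⟩,
    fun s w hs hw => ⟨MultipleHarmonic.integrableOn_unitIntegrand (hreg s w hs hw),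
      MultipleHarmonic.integrableOn_mellinIntegrand (hreg s w hs hw)⟩,
    fun K hK hKr => ⟨MultipleHarmonic.convergesAbsUniformlyOn_unitIntegrand hK hKr,
      MultipleHarmonic.convergesAbsUniformlyOn_mellinIntegrand hK hKr⟩,
    ?_, MultipleHarmonic.differentiableOn_mellinIntegral d, ?_⟩
  · rw [MultipleHarmonic.integral_unitIntegrand]
    exact (hpsi s w hs hw).2
  · rw [MultipleHarmonic.unitIntegral_eq_mellinIntegral]
    exact MultipleHarmonic.differentiableOn_mellinIntegral d
  · rw [MultipleHarmonic.unitIntegral_eq_mellinIntegral]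
    exact fun p hp => (hpsi p.1 p.2 hp.1 hp.2).2.symm
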